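/- Conventions. Computability of partial maps $\mathbb{N}^{\mathbb N}\to\mathbb{N}^{\mathbb N}$ is Type-2 computability. A multivalued operation $f:\subseteq S\rightrightarrows T$ between sets with representations $\delta,\delta'$ is $(\delta;\delta')$-computable if some computable partial map $G$ on $\mathbb{N}^{\mathbb N}$ sends every $\delta$-name of every $x\in\operatorname{dom} f$ to a $\delta'$-name of some element of $f(x)$. Tuples $\langle\cdot,\dots,\cdot\rangle$ in $\mathbb{N}^{\mathbb N}$, product representations $[\delta,\delta']$ and sequence representations $\delta^\omega$ are the standard ones; a $\delta\sqcap\delta'$-name of $x$ consists of a $\delta$-name and a $\delta'$-name of $x$. Let $(X,d,\nu)$ be a computable metric space: $d$ is a metric on $X$, $\nu:\mathbb N\to X$ has dense image and $(i,j)\mapsto d(\nu(i),\nu(j))$ is computable. Let $\delta_X$ be its Cauchy representation, $\alpha\langle a,r\rangle=B(\nu(a),\nu_{\mathbb{Q}^+}(r))$ the standard numbering of ideal balls, $\alpha'(0)=\emptyset$, $\alpha'(n+1)=\alpha(n)$. The following representations of hyperspaces are used. * $p$ is a $\delta_{\Sigma^0_1(X)}$-name of an open $U$ if $U=\bigcup_i\alpha'(p_i)$,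 and a $\delta_{\Pi^0_1(X)}$-name of a closed $A$ if it is a $\delta_{\Sigma^0_1(X)}$-name of $X\setminus A$. * A $\delta_{\rm range}$-name of a closed $A\ne\emptyset$ is a sequence of $\delta_X$-names, with all entries increased by $1$, of points of $A$ that are dense in $A$; $\emptyset$ has the zero sequence as its name. * $p$ is a $\delta^{>}_{\rm dist}$-name of a closed $A$ if $\eta_p$ maps every $\delta_X$-name of every $x\in X$ to an enumeration of $\{q\in\mathbb Q: q<d(x,A)\}$, where $d(x,\emptyset)=\infty$ and $\eta$ is the standard representation of the continuous partial maps $\mathbb{N}^{\mathbb N}\to\mathbb{N}^{\mathbb N}$ with $G_\delta$ domain. A *Dugundji system* in a metric space $Z$ for a nonempty closed $B\subseteq Z$ is a pair $((V_i)_{i\in\mathbb N},(y_i)_{i\in\mathbb N})$ of a sequence of open subsets of $Z$, locally finite in its union (each point of $\bigcup_iV_i$ has a neighbourhood that meets only finitely many $V_j$), and a sequence of points of $Z$ such that 1. $\bigcup_iV_i=Z\setminus B$, and $y_i\in B$ for all $i$; 2. $d(x,y_i)\le 2\,d(x,B)$ for all $i$ and all $x\in V_i$; 3. if $(n_i)_i\subseteq\mathbb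 N$ satisfies $\lim_i d(V_{n_i},B)=0$ then $\lim_i\operatorname{diam}V_{n_i}=0$ (where $d(\emptyset,B)=\infty$). For closed $A\subseteq X$ and $\emptyset\neq B\subseteq A$ closed, a *Dugundji system for $B$ relative to $A$* is a pair $((V_i)_i,(y_i)_i)$ with $V_i$ open in $X$ and $y_i\in X$ such that $((V_i\cap A)_i,(y_i)_i)$ is a Dugundji system for $B$ in the metric space $A$. Let $\mathcal Y$ be a class of nonempty closed subsets of $X$ with a representation $\delta_{\mathcal Y}$ such that $\delta_{\mathcal Y}\le\delta_{\Pi^0_1(X)}|^{\mathcal Y}$ (names can be computably translated). Put $$F=\{(A,B): A\in\mathcal Y,\ B\subseteq X\text{ closed},\ \emptyset\ne B\subseteq A\},\qquad \delta_5=[\delta_{\mathcal Y},\delta_{\rm range}\sqcap\delta_{\rm dist}^{>}]|^F,$$ and let $E$ be the set of all $(A;(V_i)_i,(y_i)_i)$ such that $A\in\mathcal Y$ and $((V_i)_i,(y_i)_i)$ is a Dugundji system relative to $A$ (for $A\setminus\bigcup_iV_i$). A $\delta_6$-name of $(A;(V_i)_i,(y_i)_i)\in E$ is a tuple $\langle p,\tilde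 p,\langle\tilde q,r,s\rangle,t\rangle$ such that $p$ is a $\delta_{\mathcal Y}$-name of $A$; $\tilde p$ is a $\delta^\omega_{\Sigma^0_1(X)}$-name of $(V_i)_i$; $\tilde q$ is a name of $(V_i\cap A)_i$ as a sequence of open subsets of $A$ with respect to the basis numbering $a\mapsto\alpha(a)\cap A$; $\bigcup_i(V_i\cap A)=\bigcup_i(\alpha'(r_i)\cap A)$; for each $i$, $s_i$ is the canonical code of a finite set containing every $j$ with $V_j\cap A\cap\alpha'(r_i)\neq\emptyset$; and $t$ is a $\delta_X^\omega$-name of $(y_i)_i$. **Proposition.** Suppose that the (everywhere defined, multivalued) operation $\tilde S:\Sigma^0_1(X)^{\mathbb N}\times\mathcal Y\rightrightarrows\Sigma^0_1(X)^{\mathbb N}$, $$\tilde S((V_i)_i,Y)=\Bigl\{(W_i)_i:\ (\forall i)\,W_i\subseteq V_i,\ \ \bigcup_iW_i\cap Y=\bigcup_iV_i\cap Y,\ \ (\forall i\ne j)\,W_i\cap W_j=\emptyset\Bigr\},$$ is $([\delta_{\Sigma^0_1(X)}^\omega,\delta_{\mathcal Y}];\delta_{\Sigma^0_1(X)}^\omega)$-computable.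 Then the operation $R':\subseteq F\rightrightarrows E$ with domain $\{(A,B)\in F: B\ne X\}$ and $$R'(A,B)=\Bigl\{(A;(W_i)_i,(y_i)_i)\in E:\ A\setminus\bigcup_iW_i=B\text{ and the sets }W_i\text{ are pairwise disjoint}\Bigr\}$$ is $(\delta_5;\delta_6)$-computable. -/

import Mathlib

open Set Filter Topology TopologicalSpace

/-! ### Computability on Baire space -/

namespace DugundjiZD

/-- The finite prefix `p 0, …, p (n - 1)` of a point of Baire space. -/
def pre (p : ℕ → ℕ) (n : ℕ) : List ℕ := (List.range n).map p

/-- The word function `h` produces `q` from `p`: the words `h (p 0 … p (n - 1))` are prefixes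
of `q` of unbounded length. -/
def Produces (h : List ℕ → List ℕ) (p q : ℕ → ℕ) : Prop :=
  (∀ n, h (pre p n) = pre q (h (pre p n)).length) ∧ ∀ k, ∃ n, k ≤ (h (pre p n)).length

/-- The word functions that induce the computable partial functions `ℕ^ℕ → ℕ^ℕ` (those computed
by Type-2 machines): computable and monotone for the prefix order. The induced partial function
sends `p` to the `q` with `Produces h p q`, when there is one. -/
structure IsType2Program (h : List ℕ → List ℕ) : Prop where
  computable : Computable h
  monotone : ∀ u v : List ℕ, u <+: v → h u <+: h v

/-- `⟨p, q⟩` has even part `p` and odd part `q`. -/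
def evenPart (p : ℕ → ℕ) : ℕ → ℕ := fun i => p (2 * i)

/-- The second component of a pair in Baire space. -/
def oddPart (p : ℕ → ℕ) : ℕ → ℕ := fun i => p (2 * i + 1)

/-- The `j`-th component `p⁽ʲ⁾` of `p = ⟨p⁽⁰⁾, p⁽¹⁾, …⟩`, where `p ⟨j, k⟩ = p⁽ʲ⁾ k`. -/
def component (p : ℕ → ℕ) (j : ℕ) : ℕ → ℕ := fun k => p (Nat.pair j k)

/-! ### Representations -/

/-- A naming relation: `δ p x` says that `p` is a name of `x`. -/
abbrev Naming (S : Type*) := (ℕ → ℕ) → S → Prop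

/-- The naming relation is (the graph of) a partial surjection from Baire space onto `S`. -/
structure IsRepresentation {S : Type*} (δ : Naming S) : Prop where
  functional : ∀ p x y, δ p x → δ p y → x = y
  surjective : ∀ x, ∃ p, δ p x

/-- `[δ, δ']`. -/
def prodName {S T : Type*} (δ : Naming S) (δ' : Naming T) : Naming (S × T) :=
  fun p x => δ (evenPart p) x.1 ∧ δ' (oddPart p) x.2

/-- `δ ⊓ δ'`: a name consists of a `δ`-name and a `δ'`-name of the same object. -/
def infName {S : Type*} (δ δ' : Naming S) : Naming S :=
  fun p x => δ (evenPart p) x ∧ δ' (oddPart p) x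

/-- `δ^ω`, for sequences. -/
def seqName {S : Type*} (δ : Naming S) : Naming (ℕ → S) :=
  fun p x => ∀ j, δ (component p j) (x j)

/-- The restriction `δ|^T` to names of elements of `T`. -/
def restrictName {S : Type*} (δ : Naming S) (T : Set S) : Naming T :=
  fun p x => δ p x.1

/-- The multivalued operation `f` with domain `D` is `(δ, δ')`-computable: it has a computable
realizer. -/
def ComputableOperation {S T : Type*} (δ : Naming S) (δ' : Naming T) (D : Set S)
    (f : S → Set T) : Prop :=
  ∃ h : List ℕ → List ℕ, IsType2Program h ∧
    ∀ x ∈ D, ∀ p, δ p x → ∃ q, Produces h p q ∧ ∃ y ∈ f x, δ' q y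

/-- `δ ≤ δ'`: names can be computably translated. -/
def ReducibleTo {S : Type*} (δ δ' : Naming S) : Prop :=
  ∃ h : List ℕ → List ℕ, IsType2Program h ∧
    ∀ x p, δ p x → ∃ q, Produces h p q ∧ δ' q x

/-- `q ∈ dom η_p` and `η_p(q) = t`, for the representation `η` of the continuous partial functions
`ℕ^ℕ → ℕ^ℕ` with `G_δ` domain by Kleene associates (it has the utm and smn properties, which
determine `η` up to computable equivalence): the value `t n` is `p (code (n :: w)) - 1` for the
shortest prefix `w` of `q` with `p (code (n :: w)) ≠ 0`. -/
def EtaValue (p q t : ℕ → ℕ) : Prop :=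
  ∀ n, ∃ m, p (Encodable.encode (n :: pre q m)) = t n + 1 ∧
    ∀ m' < m, p (Encodable.encode (n :: pre q m')) = 0

/-! ### Rational and extended real numbers -/

/-- A standard total numbering of the positive rationals. -/
def nuQpos (r : ℕ) : ℚ := ((r.unpair.1 : ℚ) + 1) / ((r.unpair.2 : ℚ) + 1)

/-- A standard total numbering of the rationals. -/
def nuQ (n : ℕ) : ℚ :=
  ((n.unpair.1 : ℚ) - (n.unpair.2.unpair.1 : ℚ)) / ((n.unpair.2.unpair.2 : ℚ) + 1)

/-- The representation of `[-∞, ∞]` by enumerations of all smaller rationals. -/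
def lowerName : Naming EReal :=
  fun p t => {n : ℕ | (((nuQ n : ℚ) : ℝ) : EReal) < t} = {n : ℕ | ∃ i, p i = n + 1}

/-! ### Computable metric spaces and hyperspaces -/

section Metric

variable {X : Type*} [MetricSpace X]

/-- `(X, d, ν)` is a computable metric space. -/
structure IsComputableMetricSpace (ν : ℕ → X) : Prop where
  dense : DenseRange ν
  dist_computable : ∃ f : ℕ × ℕ × ℕ → ℕ, Computable f ∧
    ∀ i j k, |dist (ν i) (ν j) - ((nuQ (f (i, j, k)) : ℚ) : ℝ)| ≤ (2 : ℝ)⁻¹ ^ k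

/-- The Cauchy representation of `X`. -/
def pointName (ν : ℕ → X) : Naming X :=
  fun p x => (∀ i j, dist (ν (p i)) (ν (p j)) < (2 : ℝ)⁻¹ ^ min i j) ∧
    Tendsto (fun i => ν (p i)) atTop (𝓝 x)

/-- The standard ball numbering `α`. -/
def ballNum (ν : ℕ → X) (a : ℕ) : Set X :=
  Metric.ball (ν a.unpair.1) ((nuQpos a.unpair.2 : ℚ) : ℝ)

/-- The shift `α'` of `α`: `α' 0 = ∅` and `α' (n + 1) = α n`. -/
def ballNumShift (ν : ℕ → X) : ℕ → Set X
  | 0 => ∅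
  | n + 1 => ballNum ν n

/-- The representation `δ_{Σ⁰₁(X)}` of the open sets, by enumerations of ideal balls. -/
def openName (ν : ℕ → X) : Naming (Opens X) :=
  fun p U => (U : Set X) = ⋃ i, ballNumShift ν (p i)

/-- The representation `δ_{Π⁰₁(X)}` of the closed sets: a name of `A` is a name of `X \ A`. -/
def closedName (ν : ℕ → X) : Naming (Closeds X) :=
  fun p A => openName ν p A.compl

/-- The representation `δ_range` of the closed sets by dense sequences; a point is named by its
Cauchy name with all entries increased by one, and `∅` is named by the zero sequence. -/
def rangeName (ν : ℕ → X) : Naming (Closeds X) :=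
  fun p A => ((A : Set X) = ∅ ∧ ∀ i, component p i = fun _ => 0) ∨
    ((A : Set X).Nonempty ∧
      (∀ i, (∀ k, 1 ≤ component p i k) ∧
        ∃ x ∈ A, pointName ν (fun k => component p i k - 1) x) ∧
      ∀ x ∈ A, ∀ U : Set X, IsOpen U → x ∈ U →
        ∃ i, ∃ y ∈ U, pointName ν (fun k => component p i k - 1) y)

/-- The representation `δ_dist^>` of the closed sets: `η_p` computes, from names of `x`, the
rational lower bounds of `d_A(x)` (with `d_∅ = ∞`). -/
def distName (ν : ℕ → X) : Naming (Closeds X) :=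
  fun p A => ∀ q x, pointName ν q x →
    ∃ t, EtaValue p q t ∧ lowerName t ((Metric.infEDist x (A : Set X) : ENNReal) : EReal)

/-! ### Dugundji systems -/

/-- `(V i)` is locally finite in its union. -/
def LocallyFiniteInUnion (V : ℕ → Opens X) : Prop :=
  ∀ i, ∀ x ∈ V i, ∃ U : Set X, IsOpen U ∧ x ∈ U ∧ {j | ((V j : Set X) ∩ U).Nonempty}.Finite

/-- The distance `d(V, A)` of two sets, with value `∞` if one of them is empty. -/
noncomputable def setDist (V A : Set X) : ENNReal := ⨅ x ∈ V, Metric.infEDist x A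

/-- `((V i), (y i))` is a Dugundji system for the nonempty closed set `A`, with coefficient
`1 + ε`. -/
structure IsDugundjiSystemFor (ε : ℝ) (A : Closeds X) (V : ℕ → Opens X) (y : ℕ → X) : Prop where
  nonempty : (A : Set X).Nonempty
  locallyFinite : LocallyFiniteInUnion V
  iUnion_eq : ⋃ i, (V i : Set X) = (A : Set X)ᶜ
  mem : ∀ i, y i ∈ A
  dist_le : ∀ i, ∀ x ∈ V i, dist x (y i) ≤ (1 + ε) * Metric.infDist x (A : Set X)
  small : ∀ n : ℕ → ℕ, Tendsto (fun i => setDist (V (n i) : Set X) (A : Set X)) atTop (𝓝 0) →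
    Tendsto (fun i => Metric.ediam (V (n i) : Set X)) atTop (𝓝 0)

/-- The set `𝒟(X)` of the Dugundji systems in `X` with coefficient `2` (for the complement of
their union). -/
def DugundjiSystems (X : Type*) [MetricSpace X] : Set ((ℕ → Opens X) × (ℕ → X)) :=
  {D | IsDugundjiSystemFor 1 (⨆ i, D.1 i).compl D.1 D.2}

/-- The trace `V ∩ A` as an open set of the subspace `A`. -/
def traceOpen (A : Closeds X) (V : Opens X) : Opens (A : Set X) :=
  ⟨Subtype.val ⁻¹' (V : Set X), V.isOpen.preimage continuous_subtype_val⟩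

/-- The set `𝒟(X, A)` of Dugundji systems relative to `A`: `((V i ∩ A), (y i)) ∈ 𝒟(A)`. -/
def RelDugundjiSystems (A : Closeds X) : Set ((ℕ → Opens X) × (ℕ → X)) :=
  {D | ∃ hy : ∀ i, D.2 i ∈ (A : Set X),
    ((fun i => traceOpen A (D.1 i)), fun i => (⟨D.2 i, hy i⟩ : (A : Set X))) ∈
      DugundjiSystems (A : Set X)}

/-! ### Classes of closed sets and the representations of inputs and outputs -/

/-- The shifted basis numbering of the subspace `A`, `α'_A n = α' n ∩ A`. -/
def ballNumRel (ν : ℕ → X) (A : Closeds X) (n : ℕ) : Set (A : Set X) :=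
  Subtype.val ⁻¹' ballNumShift ν n

/-- The representation `δ_{Σ⁰₁(A)}` of the open sets of the subspace `A` induced by
the basis numbering `α_A`. -/
def openNameRel (ν : ℕ → X) (A : Closeds X) : Naming (Opens (A : Set X)) :=
  fun p U => (U : Set (A : Set X)) = ⋃ i, ballNumRel ν A (p i)

/-- The representation `δ_{Σ⁰₁(A), α'_A}` of the sequences of open sets of `A` which are locally
finite in their union: `⟨p, ⟨q, r⟩⟩` is a name of `(U j)` if `p` is a name of the sequence, the
sets `α'_A (q i)` have the same union as the `U j`, and `r i` is the code (by binary digits) of a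
finite set containing all `j` with `U j ∩ α'_A (q i) ≠ ∅`. -/
def lfNameRel (ν : ℕ → X) (A : Closeds X) : Naming (ℕ → Opens (A : Set X)) :=
  fun p U => seqName (openNameRel ν A) (evenPart p) U ∧
    (⋃ j, (U j : Set (A : Set X))) = ⋃ i, ballNumRel ν A (evenPart (oddPart p) i) ∧
    ∀ i j, ((U j : Set (A : Set X)) ∩ ballNumRel ν A (evenPart (oddPart p) i)).Nonempty →
      (oddPart (oddPart p) i).testBit j = true

/-- `E`: triples `(A; (V i), (y i))` with `A ∈ 𝒴` and `((V i), (y i)) ∈ 𝒟(X, A)`. -/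
def SystemsOver (𝒴 : Set (Closeds X)) : Set (𝒴 × (ℕ → Opens X) × (ℕ → X)) :=
  {e | e.2 ∈ RelDugundjiSystems e.1.1}

/-- `F`: pairs `(A, B)` with `A ∈ 𝒴`, `B` closed and `∅ ≠ B ⊆ A`. -/
def PairsOver (𝒴 : Set (Closeds X)) : Set (𝒴 × Closeds X) :=
  {P | (P.2 : Set X).Nonempty ∧ (P.2 : Set X) ⊆ (P.1.1 : Set X)}

/-- `π' (A; (V i), (y i)) = (A, A \ ⋃ i, V i)`. -/
def projPair {𝒴 : Set (Closeds X)} (e : SystemsOver 𝒴) : 𝒴 × Closeds X :=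
  (e.1.1, e.1.1.1 ⊓ (⨆ i, e.1.2.1 i).compl)

/-- `δ₅ = [δ_𝒴, δ_range ⊓ δ_dist^>]|^F`. -/
def inputName (ν : ℕ → X) (𝒴 : Set (Closeds X)) (δY : Naming 𝒴) : Naming (PairsOver 𝒴) :=
  restrictName (prodName δY (infName (rangeName ν) (distName ν))) (PairsOver 𝒴)

/-- `δ₆`: a name `⟨p, ⟨p', ⟨u, t⟩⟩⟩` of `(A; (V i), (y i))` consists of a name `p` of `A`, a name
`p'` of `(V i)`, a name `u` of `(V i ∩ A)` that witnesses local finiteness in `A`, and a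
name `t` of `(y i)`. -/
def outputName (ν : ℕ → X) (𝒴 : Set (Closeds X)) (δY : Naming 𝒴) : Naming (SystemsOver 𝒴) :=
  fun p e =>
    δY (evenPart p) e.1.1 ∧
    seqName (openName ν) (evenPart (oddPart p)) e.1.2.1 ∧
    lfNameRel ν e.1.1.1 (evenPart (oddPart (oddPart p))) (fun i => traceOpen e.1.1.1 (e.1.2.1 i)) ∧
    seqName (pointName ν) (oddPart (oddPart (oddPart p))) e.1.2.2

/-! ### The two operations -/

/-- The disjointification operation `S̃`. -/
def disjointify (𝒴 : Set (Closeds X)) (a : (ℕ → Opens X) × 𝒴) : Set (ℕ → Opens X) :=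
  {W | (∀ i, (W i : Set X) ⊆ (a.1 i : Set X)) ∧
    (⋃ i, (W i : Set X)) ∩ (a.2.1 : Set X) = (⋃ i, (a.1 i : Set X)) ∩ (a.2.1 : Set X) ∧
    ∀ i j, i ≠ j → (W i : Set X) ∩ (W j : Set X) = ∅}

/-- The operation `R'`: the Dugundji systems for `B` relative to `A` with pairwise disjoint
open sets. -/
def disjointSystems (𝒴 : Set (Closeds X)) (P : PairsOver 𝒴) : Set (SystemsOver 𝒴) :=
  {e | projPair e = P.1 ∧
    ∀ i j, i ≠ j → (e.1.2.1 i : Set X) ∩ (e.1.2.1 j : Set X) = ∅}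

end Metric

end DugundjiZD

namespace DugundjiZD

/-! ### Type-2 programs -/

/-! From the name of `B`, search for balls around ideal points `ν a`, of radius `r`, for which
finitely many entries prove, for some rational `c`, that `8 * r < c < d (ν a, B)` and, for some
point `y k` of the dense sequence in `B`, that `d (ν a, y k) < 3/2 * c`. These balls `V i` cover
exactly the complement of `B` (`certBall_sound`, `exists_mem_certBall`). The triangle inequality
shows that every `z` in such a ball satisfies `d (z, y k) ≤ 2 * d (z, B)`, and that the diameter of
the ball is at most `d (z, B)`. Both estimates pass to open subsets, so the disjointification of `(V
i)` over `A` yields `W i ⊆ V i` that satisfy conditions 2 and 3 with the same points. The family `(V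
i)` need not be locally finite: pairwise disjoint open sets always are, since `W i` is itself a
neighbourhood that meets only `W i` (`mem_relDugundjiSystems`). The same remark gives the witness of
local finiteness for free: a ball listed for `W j` gets the finite set `{j}`
(`lfNameRel_of_disjoint`). The realizer is a composition of three programs: list the certified
balls, apply the realizer of the disjointification while keeping the input, and rearrange the
entries. -/

theorem map_range_prefix {f g : ℕ → ℕ} {n m : ℕ} (hnm : n ≤ m) (h : ∀ i < n, f i = g i) :
    (List.range n).map f <+: (List.range m).map g := by
  obtain ⟨k, rfl⟩ := Nat.exists_eq_add_of_le hnm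
  rw [List.range_add, List.map_append, List.map_congr_left (g := g)]
  · exact List.prefix_append _ _
  · intro i hi
    exact h i (List.mem_range.1 hi)

@[simp] theorem length_pre (p : ℕ → ℕ) (n : ℕ) : (pre p n).length = n := by simp [pre]

theorem pre_prefix (p : ℕ → ℕ) {n m : ℕ} (h : n ≤ m) : pre p n <+: pre p m :=
  map_range_prefix h fun _ _ => rfl

theorem take_pre (p : ℕ → ℕ) {n m : ℕ} (h : n ≤ m) : (pre p m).take n = pre p n := by
  have := List.prefix_iff_eq_take.1 (pre_prefix p h)
  rw [length_pre] at this
  exact this.symm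

theorem getD_pre_of_lt (p : ℕ → ℕ) {j n : ℕ} (h : j < n) (d : ℕ) : (pre p n).getD j d = p j := by
  simp [pre, List.getD_eq_getElem?_getD, h]

theorem getD_pre_of_le (p : ℕ → ℕ) {j n : ℕ} (h : n ≤ j) (d : ℕ) : (pre p n).getD j d = d := by
  simp [pre, List.getD_eq_getElem?_getD, h]

/-- The list is built by recursion on its length, as `g` is only computable and not primitive
recursive. -/
theorem computable_map_range {α : Type*} [Primcodable α] {f : α → ℕ} {g : α → ℕ → ℕ}
    (hf : Computable f) (hg : Computable₂ g) :
    Computable fun a => (List.range (f a)).map (g a) := by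
  have : Computable fun a => Nat.rec (motive := fun _ => List ℕ) []
      (fun n l => l ++ [g a n]) (f a) :=
    Computable.nat_rec hf (Computable.const []) <|
      (Primrec.list_concat.to_comp.comp (Computable.snd.comp Computable.snd)
        (hg.comp Computable.fst (Computable.fst.comp Computable.snd))).to₂
  refine this.of_eq fun a => ?_
  induction f a with
  | zero => rfl
  | succ n ih => rw [List.range_succ, List.map_append]; simp only [ih]; rfl

theorem IsType2Program.comp {g h : List ℕ → List ℕ} (hg : IsType2Program g)
    (hh : IsType2Program h) : IsType2Program fun u => g (h u) :=
  ⟨hg.computable.comp hh.computable, fun u v huv => hg.monotone _ _ (hh.monotone u v huv)⟩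

/-- Intermediate words are prefixes of `q` of uncontrolled length; monotonicity of `g` ensures that
a longer one does not shorten the output. -/
theorem Produces.comp {g h : List ℕ → List ℕ} (hg : IsType2Program g) {p q r : ℕ → ℕ}
    (h₁ : Produces h p q) (h₂ : Produces g q r) : Produces (fun u => g (h u)) p r := by
  refine ⟨fun n => ?_, fun k => ?_⟩
  · have := h₂.1 (h (pre p n)).length
    rwa [← h₁.1 n] at this
  · obtain ⟨m, hm⟩ := h₂.2 k
    obtain ⟨n, hn⟩ := h₁.2 m
    refine ⟨n, hm.trans ?_⟩
    change _ ≤ (g (h (pre p n))).length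
    rw [h₁.1 n]
    exact (hg.monotone _ _ (pre_prefix q hn)).length_le

/-- The word function whose `n`-th output entry is `F` of `n` and the input prefix of length
`8 * (n + 1)`. -/
def localProgram (F : ℕ × List ℕ → ℕ) (u : List ℕ) : List ℕ :=
  (List.range (u.length / 8)).map fun n => F (n, u.take (8 * (n + 1)))

theorem isType2Program_localProgram {F : ℕ × List ℕ → ℕ} (hF : Computable F) :
    IsType2Program (localProgram F) := by
  refine ⟨?_, fun u v huv => ?_⟩
  · refine computable_map_range
      (Primrec.nat_div.comp Primrec.list_length (Primrec.const 8)).to_comp ?_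
    refine hF.comp (Computable.snd.pair ?_)
    exact (Primrec.list_take.comp (Primrec.nat_mul.comp (Primrec.const 8)
      (Primrec.succ.comp Primrec.snd)) Primrec.fst).to_comp
  · refine map_range_prefix (Nat.div_le_div_right huv.length_le) fun i hi => ?_
    obtain ⟨w, rfl⟩ := huv
    rw [List.take_append_of_le_length (by omega)]

theorem produces_localProgram (F : ℕ × List ℕ → ℕ) (p : ℕ → ℕ) :
    Produces (localProgram F) p fun n => F (n, pre p (8 * (n + 1))) := by
  refine ⟨fun n => ?_, fun k => ⟨8 * k, ?_⟩⟩
  · simp only [localProgram, pre, List.length_map, List.length_range]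
    refine List.map_congr_left fun i hi => ?_
    rw [List.mem_range] at hi
    exact congrArg (fun l => F (i, l)) (take_pre p (by omega))
  · simp [localProgram]

/-- The point `⟨p, q⟩` of Baire space. -/
def interleave (p q : ℕ → ℕ) (i : ℕ) : ℕ := if i % 2 = 0 then p (i / 2) else q (i / 2)

/-- The word function that pairs the input with the output of `h`. -/
def pairProgram (h : List ℕ → List ℕ) (u : List ℕ) : List ℕ :=
  (List.range (2 * min u.length (h u).length)).map
    (interleave (fun i => u.getD i 0) fun i => (h u).getD i 0)

theorem getD_eq_of_prefix {u v : List ℕ} (h : u <+: v) {i : ℕ} (hi : i < u.length) :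
    u.getD i 0 = v.getD i 0 := by
  obtain ⟨w, rfl⟩ := h
  simp [List.getD_eq_getElem?_getD, List.getElem?_append_left hi]

theorem isType2Program_pairProgram {h : List ℕ → List ℕ} (hh : IsType2Program h) :
    IsType2Program (pairProgram h) := by
  refine ⟨?_, fun u v huv => ?_⟩
  · have : Primrec fun w : List ℕ × List ℕ => (List.range (2 * min w.1.length w.2.length)).map
        (interleave (fun i => w.1.getD i 0) fun i => w.2.getD i 0) := by
      refine Primrec.list_map (Primrec.list_range.comp (Primrec.nat_mul.comp (Primrec.const 2)
        (Primrec.nat_min.comp (Primrec.list_length.comp Primrec.fst)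
          (Primrec.list_length.comp Primrec.snd)))) ?_
      have half : Primrec fun a : (List ℕ × List ℕ) × ℕ => a.2 / 2 :=
        Primrec.nat_div.comp Primrec.snd (Primrec.const 2)
      exact Primrec.ite (Primrec.eq.comp (Primrec.nat_mod.comp Primrec.snd (Primrec.const 2))
        (Primrec.const 0)) ((Primrec.list_getD 0).comp (Primrec.fst.comp Primrec.fst) half)
        ((Primrec.list_getD 0).comp (Primrec.snd.comp Primrec.fst) half)
    exact this.to_comp.comp (Computable.id.pair hh.computable)
  · have h₁ := huv.length_le
    have h₂ := (hh.monotone u v huv).length_le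
    refine map_range_prefix (by omega) fun i hi => ?_
    simp only [interleave]
    split_ifs
    · exact getD_eq_of_prefix huv (by omega)
    · exact getD_eq_of_prefix (hh.monotone u v huv) (by omega)

theorem Produces.pairProgram {h : List ℕ → List ℕ} (hh : IsType2Program h) {p q : ℕ → ℕ}
    (hp : Produces h p q) : Produces (pairProgram h) p (interleave p q) := by
  refine ⟨fun n => ?_, fun k => ?_⟩
  · simp only [DugundjiZD.pairProgram, List.length_map, List.length_range]
    refine List.map_congr_left fun i hi => ?_
    rw [List.mem_range, length_pre] at hi
    simp only [interleave]
    split_ifs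
    · exact getD_pre_of_lt p (by omega) 0
    · rw [hp.1 n]
      exact getD_pre_of_lt q (by omega) 0
  · obtain ⟨n, hn⟩ := hp.2 k
    -- The paired word is limited by the shorter component: `k` makes the input long enough, `n` the
    -- output of `h`.
    refine ⟨max n k, ?_⟩
    have := (hh.monotone _ _ (pre_prefix p (le_max_left n k))).length_le
    simp only [DugundjiZD.pairProgram, List.length_map, List.length_range, length_pre]
    omega

/-! ### Certified balls -/

/-- Clearing denominators turns the rational test into one on natural numbers, visibly primitive
recursive. -/
theorem lt_nuQ_iff (r c : ℕ) : 8 * nuQpos r < nuQ c ↔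
    8 * (r.unpair.1 + 1) * (c.unpair.2.unpair.2 + 1) + c.unpair.2.unpair.1 * (r.unpair.2 + 1) <
      c.unpair.1 * (r.unpair.2 + 1) := by
  rw [nuQpos, nuQ, ← mul_div_assoc, div_lt_div_iff₀ (by positivity) (by positivity), sub_mul,
    lt_sub_iff_add_lt]
  exact_mod_cast Iff.rfl

/-- The summand `2 / (l + 1)` absorbs two errors: that of the approximate distance `e`, and that of
replacing a point by the `l`-th entry of its name. -/
theorem add_lt_nuQ_iff (e c l : ℕ) : nuQ e + 2 / (l + 1) < 3 / 2 * nuQ c ↔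
    2 * (l + 1) * (c.unpair.2.unpair.2 + 1) * e.unpair.1 +
        (4 * (e.unpair.2.unpair.2 + 1) * (c.unpair.2.unpair.2 + 1) +
          3 * c.unpair.2.unpair.1 * (e.unpair.2.unpair.2 + 1) * (l + 1)) <
      3 * c.unpair.1 * (e.unpair.2.unpair.2 + 1) * (l + 1) +
        2 * e.unpair.2.unpair.1 * (l + 1) * (c.unpair.2.unpair.2 + 1) := by
  generalize ha : e.unpair.1 = a
  generalize hb : e.unpair.2.unpair.1 = b
  generalize hd : e.unpair.2.unpair.2 = d
  generalize ha' : c.unpair.1 = a'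
  generalize hb' : c.unpair.2.unpair.1 = b'
  generalize hd' : c.unpair.2.unpair.2 = d'
  rw [nuQ, nuQ, ha, hb, hd, ha', hb', hd', div_add_div _ _ (by positivity) (by positivity),
    div_mul_div_comm, div_lt_div_iff₀ (by positivity) (by positivity), ← @Nat.cast_lt ℚ]
  push_cast
  constructor <;> intro h <;> linarith

/-- The word `v` is a prefix of a name `⟨w, ⟨y, z⟩⟩`, with `y` a `δ_range`-name and `z` a
`δ_dist^>`-name of a set `B`, and shows (by the `n`-th output of `z` on the constant name of
`ν a`, read off after `m` steps) that the rational `c` is below the distance of `ν a` to `B`;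
moreover `c` is large compared with the radius `r` and with the distance of `ν a` to the `k`-th
point of `y`, as seen from the approximation `e` with precision `l`. -/
def Certificate (e k a r n m c l : ℕ) (v : List ℕ) : Prop :=
  (∀ m' < m, v.getD (4 * Encodable.encode (n :: pre (fun _ => a) m') + 3) 1 = 0) ∧
    v.getD (4 * Encodable.encode (n :: pre (fun _ => a) m) + 3) 1 = c + 2 ∧
    ¬ v.getD (4 * Nat.pair k l + 1) 0 = 0 ∧
    8 * (r.unpair.1 + 1) * (c.unpair.2.unpair.2 + 1) + c.unpair.2.unpair.1 * (r.unpair.2 + 1) <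
      c.unpair.1 * (r.unpair.2 + 1) ∧
    2 * (l + 1) * (c.unpair.2.unpair.2 + 1) * e.unpair.1 +
        (4 * (e.unpair.2.unpair.2 + 1) * (c.unpair.2.unpair.2 + 1) +
          3 * c.unpair.2.unpair.1 * (e.unpair.2.unpair.2 + 1) * (l + 1)) <
      3 * c.unpair.1 * (e.unpair.2.unpair.2 + 1) * (l + 1) +
        2 * e.unpair.2.unpair.1 * (l + 1) * (c.unpair.2.unpair.2 + 1)

/-! ### Decidability of certificates -/

section Primrec

variable {α : Type*} [Primcodable α]

theorem primrec_unpair_fst {f : α → ℕ} (hf : Primrec f) : Primrec fun x => (f x).unpair.1 :=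
  Primrec.fst.comp (Primrec.unpair.comp hf)

theorem primrec_unpair_snd {f : α → ℕ} (hf : Primrec f) : Primrec fun x => (f x).unpair.2 :=
  Primrec.snd.comp (Primrec.unpair.comp hf)

theorem primrec_add {f g : α → ℕ} (hf : Primrec f) (hg : Primrec g) :
    Primrec fun x => f x + g x := Primrec.nat_add.comp hf hg

theorem primrec_mul {f g : α → ℕ} (hf : Primrec f) (hg : Primrec g) :
    Primrec fun x => f x * g x := Primrec.nat_mul.comp hf hg

theorem primrec_assoc_index {f g h : α → ℕ} (hf : Primrec f) (hg : Primrec g) (hh : Primrec h) :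
    Primrec fun x => 4 * Encodable.encode (f x :: pre (fun _ => g x) (h x)) + 3 :=
  primrec_add (primrec_mul (Primrec.const 4) (Primrec.encode.comp (Primrec.list_cons.comp hf
    (Primrec.list_map (Primrec.list_range.comp hh) (hg.comp Primrec.fst).to₂)))) (Primrec.const 3)

/-- The approximate distance `e` is a separate argument because the function computing it need not
be primitive recursive; everything else in the test is. -/
theorem primrecPred_certificate {e k a r n m c l : α → ℕ} {v : α → List ℕ} (he : Primrec e)
    (hk : Primrec k) (ha : Primrec a) (hr : Primrec r) (hn : Primrec n) (hm : Primrec m)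
    (hc : Primrec c) (hl : Primrec l) (hv : Primrec v) :
    PrimrecPred fun x => Certificate (e x) (k x) (a x) (r x) (n x) (m x) (c x) (l x) (v x) := by
  have one : ∀ {f : α → ℕ}, Primrec f → Primrec fun x => f x + 1 := fun hf =>
    primrec_add hf (Primrec.const 1)
  have c1 := primrec_unpair_fst hc
  have c2 := primrec_unpair_fst (primrec_unpair_snd hc)
  have c3 := one (primrec_unpair_snd (primrec_unpair_snd hc))
  have e1 := primrec_unpair_fst he
  have e2 := primrec_unpair_fst (primrec_unpair_snd he)
  have e3 := one (primrec_unpair_snd (primrec_unpair_snd he))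
  have r1 := one (primrec_unpair_fst hr)
  have r2 := one (primrec_unpair_snd hr)
  have l1 := one hl
  have num : ∀ (d : ℕ) {f : α → ℕ}, Primrec f → Primrec fun x => d * f x := fun d _ hf =>
    primrec_mul (Primrec.const d) hf
  refine PrimrecPred.and ?_ (PrimrecPred.and ?_ (PrimrecPred.and ?_ (PrimrecPred.and ?_ ?_)))
  · have : PrimrecRel fun (m' : ℕ) (x : ℕ × ℕ × List ℕ) =>
        x.2.2.getD (4 * Encodable.encode (x.1 :: pre (fun _ => x.2.1) m') + 3) 1 = 0 :=
      Primrec.eq.comp ((Primrec.list_getD 1).comp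
        (Primrec.snd.comp (Primrec.snd.comp Primrec.snd))
        (primrec_assoc_index (Primrec.fst.comp Primrec.snd)
          (Primrec.fst.comp (Primrec.snd.comp Primrec.snd)) Primrec.fst)) (Primrec.const 0)
    exact (this.forall_mem_list.comp (Primrec.list_range.comp hm) (hn.pair (ha.pair hv))).of_eq
      fun x => by simp only [List.mem_range]
  · exact Primrec.eq.comp ((Primrec.list_getD 1).comp hv (primrec_assoc_index hn ha hm))
      (primrec_add hc (Primrec.const 2))
  · exact (Primrec.eq.comp ((Primrec.list_getD 0).comp hv (primrec_add
      (num 4 (Primrec₂.natPair.comp hk hl)) (Primrec.const 1))) (Primrec.const 0)).not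
  · exact Primrec.nat_lt.comp (primrec_add (primrec_mul (num 8 r1) c3) (primrec_mul c2 r2))
      (primrec_mul c1 r2)
  · exact Primrec.nat_lt.comp
      (primrec_add (primrec_mul (primrec_mul (num 2 l1) c3) e1)
        (primrec_add (primrec_mul (num 4 e3) c3) (primrec_mul (primrec_mul (num 3 c2) e3) l1)))
      (primrec_add (primrec_mul (primrec_mul (num 3 c1) e3) l1)
        (primrec_mul (primrec_mul (num 2 e2) l1) c3))

end Primrec

/-- The parameters `(a, r, n, m, c, l)` of the certificate with number `i`. -/
def certData (i : ℕ) : ℕ × ℕ × ℕ × ℕ × ℕ × ℕ := Denumerable.ofNat _ i.unpair.2.unpair.2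

/-- The number in the dense sequence of the point that belongs to the certificate with
number `i`. -/
def certPoint (i : ℕ) : ℕ := i.unpair.2.unpair.1

theorem certPoint_le (i : ℕ) : certPoint i ≤ i :=
  (Nat.unpair_left_le _).trans (Nat.unpair_right_le _)

open Classical in
/-- The number (with respect to `α'`) of the `i`-th certified ball, as read off from the prefix of
length `i` of the input `u`. -/
noncomputable def ballCode (f : ℕ × ℕ × ℕ → ℕ) (i : ℕ) (u : List ℕ) : ℕ :=
  if Certificate (f ((certData i).1,
        (u.take i).getD (4 * Nat.pair (certPoint i) (certData i).2.2.2.2.2 + 1) 0 - 1,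
        (certData i).2.2.2.2.2))
      (certPoint i) (certData i).1 (certData i).2.1 (certData i).2.2.1 (certData i).2.2.2.1
      (certData i).2.2.2.2.1 (certData i).2.2.2.2.2 (u.take i)
  then Nat.pair (certData i).1 (certData i).2.1 + 1 else 0

theorem computable_ballCode {f : ℕ × ℕ × ℕ → ℕ} (hf : Computable f) :
    Computable fun x : ℕ × List ℕ => ballCode f x.1 x.2 := by
  classical
  have hcert : Primrec certPoint := primrec_unpair_fst (primrec_unpair_snd Primrec.id)
  have hdata : Primrec certData :=
    (Primrec.ofNat _).comp (primrec_unpair_snd (primrec_unpair_snd Primrec.id))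
  have htake : Primrec fun x : ℕ × List ℕ => x.2.take x.1 :=
    Primrec.list_take.comp Primrec.fst Primrec.snd
  have hd : Primrec fun x : ℕ × List ℕ => certData x.1 := hdata.comp Primrec.fst
  have hk : Primrec fun x : ℕ × List ℕ => certPoint x.1 := hcert.comp Primrec.fst
  have ha := Primrec.fst.comp hd
  have h₁ := Primrec.snd.comp hd
  have hr := Primrec.fst.comp h₁
  have h₂ := Primrec.snd.comp h₁
  have hn := Primrec.fst.comp h₂
  have h₃ := Primrec.snd.comp h₂
  have hm := Primrec.fst.comp h₃
  have h₄ := Primrec.snd.comp h₃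
  have hc := Primrec.fst.comp h₄
  have hl := Primrec.snd.comp h₄
  have hb : Primrec fun x : ℕ × List ℕ =>
      (x.2.take x.1).getD (4 * Nat.pair (certPoint x.1) (certData x.1).2.2.2.2.2 + 1) 0 - 1 :=
    Primrec.nat_sub.comp ((Primrec.list_getD 0).comp htake (primrec_add
      (primrec_mul (Primrec.const 4) (Primrec₂.natPair.comp hk hl)) (Primrec.const 1)))
      (Primrec.const 1)
  have he : Computable fun x : ℕ × List ℕ => f ((certData x.1).1,
      (x.2.take x.1).getD (4 * Nat.pair (certPoint x.1) (certData x.1).2.2.2.2.2 + 1) 0 - 1,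
      (certData x.1).2.2.2.2.2) :=
    hf.comp (ha.pair (hb.pair hl)).to_comp
  have s := @Primrec.snd ℕ (ℕ × List ℕ) _ _
  have key : Primrec fun z : ℕ × ℕ × List ℕ =>
      if Certificate z.1 (certPoint z.2.1) (certData z.2.1).1 (certData z.2.1).2.1
        (certData z.2.1).2.2.1 (certData z.2.1).2.2.2.1 (certData z.2.1).2.2.2.2.1
        (certData z.2.1).2.2.2.2.2 (z.2.2.take z.2.1)
      then Nat.pair (certData z.2.1).1 (certData z.2.1).2.1 + 1 else 0 :=
    Primrec.ite (primrecPred_certificate Primrec.fst (hk.comp s) (ha.comp s) (hr.comp s)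
      (hn.comp s) (hm.comp s) (hc.comp s) (hl.comp s) (htake.comp s))
      (Primrec.succ.comp (Primrec₂.natPair.comp (ha.comp s) (hr.comp s))) (Primrec.const 0)
  refine (key.to_comp.comp (he.pair Computable.id)).of_eq fun x => ?_
  simp only [ballCode, id_eq]

/-! ### Soundness and completeness of certificates -/

section Metric

variable {X : Type*} [MetricSpace X]

theorem pointName.dist_le {ν : ℕ → X} {p : ℕ → ℕ} {x : X} (h : pointName ν p x) (l : ℕ) :
    dist (ν (p l)) x ≤ (2 : ℝ)⁻¹ ^ l := by
  refine le_of_tendsto (tendsto_const_nhds.dist h.2) ?_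
  filter_upwards [eventually_ge_atTop l] with i hi
  have := h.1 l i
  rw [min_eq_left hi] at this
  exact this.le

theorem pointName_const (ν : ℕ → X) (a : ℕ) : pointName ν (fun _ => a) (ν a) :=
  ⟨fun i j => by rw [dist_self]; positivity, tendsto_const_nhds⟩

/-- This weaker bound keeps the certificate polynomial in `l`. -/
theorem inv_two_pow_le (l : ℕ) : (2 : ℝ)⁻¹ ^ l ≤ 1 / ((l : ℝ) + 1) := by
  rw [inv_pow, ← one_div]
  refine one_div_le_one_div_of_le (by positivity) ?_
  exact_mod_cast Nat.lt_two_pow_self (n := l)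

theorem coe_lt_infEDist_iff {B : Set X} (hB : B.Nonempty) (x : X) (c : ℝ) :
    (c : EReal) < ((Metric.infEDist x B : ENNReal) : EReal) ↔ c < Metric.infDist x B := by
  rw [Metric.infDist, ← EReal.coe_lt_coe_iff,
    EReal.coe_ennreal_toReal (Metric.infEDist_ne_top hB)]

/-- The assertions about `ν a` that a certificate proves. -/
theorem Certificate.sound {ν : ℕ → X} {f : ℕ × ℕ × ℕ → ℕ}
    (hf : ∀ i j k, |dist (ν i) (ν j) - ((nuQ (f (i, j, k)) : ℚ) : ℝ)| ≤ (2 : ℝ)⁻¹ ^ k)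
    {B : Closeds X} (hB : (B : Set X).Nonempty) {p : ℕ → ℕ}
    (hp : distName ν (oddPart (oddPart p)) B) {y : X} {N k a r n m c l : ℕ}
    (hy : pointName ν (fun j => component (evenPart (oddPart p)) k j - 1) y)
    (h : Certificate (f (a, (pre p N).getD (4 * Nat.pair k l + 1) 0 - 1, l)) k a r n m c l
      (pre p N)) :
    ((nuQ c : ℚ) : ℝ) < Metric.infDist (ν a) B ∧
      8 * ((nuQpos r : ℚ) : ℝ) < ((nuQ c : ℚ) : ℝ) ∧
      dist (ν a) y < 3 / 2 * ((nuQ c : ℚ) : ℝ) := by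
  obtain ⟨h₁, h₂, h₃, h₄, h₅⟩ := h
  refine ⟨?_, ?_, ?_⟩
  · obtain ⟨t, ht, ht'⟩ := hp _ _ (pointName_const ν a)
    rw [← coe_lt_infEDist_iff hB]
    -- Positions beyond the prefix are read as `1`, which is neither the `0` nor the `c + 2` that
    -- the certificate asks for, so both answers are genuine entries.
    have read : ∀ j d, d ≠ 1 → (pre p N).getD (4 * j + 3) 1 = d →
        oddPart (oddPart p) j = d := by
      intro j d hd hj
      have hlt : 4 * j + 3 < N := by
        by_contra hge
        rw [getD_pre_of_le p (not_lt.1 hge)] at hj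
        exact hd hj.symm
      rw [getD_pre_of_lt p hlt] at hj
      rw [← hj, oddPart, oddPart]
      congr 1
      ring
    obtain ⟨m₀, hm₀, hm₀'⟩ := ht n
    have hm := read _ _ (by omega) h₂
    -- An associate is evaluated at the first nonzero entry, so the verified zeros before `m`
    -- identify `m` with the true stopping time.
    have hmm : m₀ = m := by
      rcases lt_trichotomy m₀ m with hlt | heq | hgt
      · have := read _ _ (by omega) (h₁ m₀ hlt)
        omega
      · exact heq
      · have := hm₀' m hgt
        omega
    subst hmm
    have : c ∈ {n : ℕ | ∃ i, t i = n + 1} := ⟨n, by omega⟩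
    rwa [← ht'] at this
  · exact_mod_cast (lt_nuQ_iff r c).2 h₄
  · have hlt : 4 * Nat.pair k l + 1 < N := by
      by_contra hge
      exact h₃ (getD_pre_of_le p (not_lt.1 hge) 0)
    rw [getD_pre_of_lt p hlt] at h₅
    have hyl := hy.dist_le l
    have hidx : component (evenPart (oddPart p)) k l = p (4 * Nat.pair k l + 1) := by
      simp only [component, evenPart, oddPart]
      congr 1
      ring
    rw [hidx] at hyl
    have h₅' := (add_lt_nuQ_iff _ c l).2 h₅
    have h₆ : (((nuQ (f (a, p (4 * Nat.pair k l + 1) - 1, l)) : ℚ) : ℝ) + 2 / ((l : ℝ) + 1)) <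
        3 / 2 * ((nuQ c : ℚ) : ℝ) := by
      have := (Rat.cast_lt (K := ℝ)).2 h₅'
      push_cast at this
      exact this
    have h₇ := (abs_le.1 (hf a (p (4 * Nat.pair k l + 1) - 1) l)).2
    have h₈ := inv_two_pow_le l
    have h₉ := dist_triangle (ν a) (ν (p (4 * Nat.pair k l + 1) - 1)) y
    have h₀ : 2 / ((l : ℝ) + 1) = 1 / ((l : ℝ) + 1) + 1 / ((l : ℝ) + 1) := by ring
    linarith

/-- Every true assertion has a certificate in all sufficiently long prefixes. -/
theorem Certificate.complete {ν : ℕ → X} {f : ℕ × ℕ × ℕ → ℕ}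
    (hf : ∀ i j k, |dist (ν i) (ν j) - ((nuQ (f (i, j, k)) : ℚ) : ℝ)| ≤ (2 : ℝ)⁻¹ ^ k)
    {B : Closeds X} (hB : (B : Set X).Nonempty) {p : ℕ → ℕ}
    (hp : distName ν (oddPart (oddPart p)) B) {y : X} {k a r c : ℕ}
    (hy : pointName ν (fun j => component (evenPart (oddPart p)) k j - 1) y)
    (hpos : ∀ j, 1 ≤ component (evenPart (oddPart p)) k j)
    (h₁ : ((nuQ c : ℚ) : ℝ) < Metric.infDist (ν a) B)
    (h₂ : 8 * ((nuQpos r : ℚ) : ℝ) < ((nuQ c : ℚ) : ℝ))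
    (h₃ : dist (ν a) y < 3 / 2 * ((nuQ c : ℚ) : ℝ)) :
    ∃ n m l L, ∀ N, L ≤ N →
      Certificate (f (a, (pre p N).getD (4 * Nat.pair k l + 1) 0 - 1, l)) k a r n m c l
        (pre p N) := by
  obtain ⟨t, ht, ht'⟩ := hp _ _ (pointName_const ν a)
  rw [← coe_lt_infEDist_iff hB] at h₁
  obtain ⟨n, hn⟩ : c ∈ {n : ℕ | ∃ i, t i = n + 1} := by rw [← ht']; exact h₁
  obtain ⟨m, hm, hm'⟩ := ht n
  -- Four errors of size at most `1 / (l + 1)` must fit into the gap: two in the estimate of the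
  -- distance and two in the safety margin of the test.
  obtain ⟨l, hl⟩ := exists_nat_one_div_lt
    (show (0 : ℝ) < (3 / 2 * ((nuQ c : ℚ) : ℝ) - dist (ν a) y) / 4 by linarith)
  -- A sum serves as an upper bound for the finitely many positions consulted.
  have hL : ∃ L, 4 * Nat.pair k l + 1 < L ∧
      ∀ m' ≤ m, 4 * Encodable.encode (n :: pre (fun _ => a) m') + 3 < L := by
    refine ⟨4 * Nat.pair k l + 2 + ∑ m' ∈ Finset.range (m + 1),
      (4 * Encodable.encode (n :: pre (fun _ => a) m') + 4), by omega, fun m' hm' => ?_⟩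
    have := Finset.single_le_sum (s := Finset.range (m + 1))
      (f := fun m' => 4 * Encodable.encode (n :: pre (fun _ => a) m') + 4)
      (fun _ _ => Nat.zero_le _) (Finset.mem_range.2 (Nat.lt_succ_of_le hm'))
    omega
  obtain ⟨L, hL₁, hL₂⟩ := hL
  refine ⟨n, m, l, L, fun N hN => ?_⟩
  have hidx : component (evenPart (oddPart p)) k l = p (4 * Nat.pair k l + 1) := by
    simp only [component, evenPart, oddPart]
    congr 1
    ring
  have read : ∀ m' ≤ m, (pre p N).getD (4 * Encodable.encode (n :: pre (fun _ => a) m') + 3) 1 =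
      oddPart (oddPart p) (Encodable.encode (n :: pre (fun _ => a) m')) := by
    intro m' hm'
    rw [getD_pre_of_lt p ((hL₂ m' hm').trans_le hN), oddPart, oddPart]
    congr 1
    ring
  rw [getD_pre_of_lt p (hL₁.trans_le hN)]
  refine ⟨fun m' hlt => ?_, ?_, ?_, ?_, ?_⟩
  · rw [read m' hlt.le, hm' m' hlt]
  · rw [read m le_rfl, hm, hn]
  · rw [getD_pre_of_lt p (hL₁.trans_le hN), ← hidx]
    have := hpos l
    omega
  · exact (lt_nuQ_iff r c).1 (by exact_mod_cast h₂)
  · refine (add_lt_nuQ_iff _ c l).1 ?_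
    have hyl := hy.dist_le l
    rw [hidx] at hyl
    have h₇ := (abs_le.1 (hf a (p (4 * Nat.pair k l + 1) - 1) l)).1
    have h₈ := inv_two_pow_le l
    have h₉ := dist_triangle_right (ν a) (ν (p (4 * Nat.pair k l + 1) - 1)) y
    have h₀ : 2 / ((l : ℝ) + 1) = 1 / ((l : ℝ) + 1) + 1 / ((l : ℝ) + 1) := by ring
    have : (((nuQ (f (a, p (4 * Nat.pair k l + 1) - 1, l)) : ℚ) : ℝ) + 2 / ((l : ℝ) + 1)) <
        3 / 2 * ((nuQ c : ℚ) : ℝ) := by linarith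
    rw [← Rat.cast_lt (K := ℝ)]
    push_cast
    exact this

end Metric

/-! ### Disjoint refinements of Dugundji systems -/

section Metric

variable {X : Type*} [MetricSpace X]

/-- If the open sets `V i` cover the complement of `B`, lie close to the points `y i` of `B`, and
have a diameter below their distance to `B`, then every disjoint family of open sets `W i ⊆ V i`
with the same union in `A` is part of a Dugundji system for `B` relative to `A`. -/
theorem mem_relDugundjiSystems {A B : Closeds X} (hB : (B : Set X).Nonempty)
    (hBA : (B : Set X) ⊆ A) {V W : ℕ → Opens X} {y : ℕ → X}
    (hV : ⋃ i, (V i : Set X) = (B : Set X)ᶜ) (hy : ∀ i, y i ∈ B)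
    (hdist : ∀ i, ∀ x ∈ V i, dist x (y i) ≤ 2 * Metric.infDist x (B : Set X))
    (hdiam : ∀ i, ∀ x ∈ V i, ∀ x' ∈ V i, ∀ z ∈ V i, dist x x' ≤ Metric.infDist z (B : Set X))
    (hWV : ∀ i, (W i : Set X) ⊆ V i)
    (hWA : (⋃ i, (W i : Set X)) ∩ (A : Set X) = (⋃ i, (V i : Set X)) ∩ (A : Set X))
    (hW : ∀ i j, i ≠ j → (W i : Set X) ∩ (W j : Set X) = ∅) :
    (W, y) ∈ RelDugundjiSystems A := by
  refine ⟨fun i => hBA (hy i), ?_⟩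
  -- Inside `A`, the complement of the union of the traces is `B`; since `B ⊆ A`, distances to `B`
  -- are the same in `A` and in `X`.
  have hC : (((⨆ i, traceOpen A (W i)).compl : Closeds (A : Set X)) : Set (A : Set X)) =
      Subtype.val ⁻¹' (B : Set X) := by
    ext x
    have hx := Set.ext_iff.1 hWA x.1
    rw [hV] at hx
    simp only [mem_inter_iff, mem_iUnion, x.2, and_true, mem_compl_iff] at hx
    simp only [Opens.coe_compl, Opens.coe_iSup, mem_compl_iff, mem_iUnion, mem_preimage]
    exact not_iff_comm.1 hx.symm
  have himage : (Subtype.val '' (Subtype.val ⁻¹' (B : Set X) : Set (A : Set X))) = (B : Set X) := by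
    rw [Subtype.image_preimage_coe, inter_eq_right.2 hBA]
  have hinf : ∀ x : (A : Set X),
      Metric.infDist x (Subtype.val ⁻¹' (B : Set X) : Set (A : Set X)) =
        Metric.infDist x.1 (B : Set X) := fun x => by
    rw [← Metric.infDist_image isometry_subtype_coe, himage]
  have hinfE : ∀ x : (A : Set X),
      Metric.infEDist x (Subtype.val ⁻¹' (B : Set X) : Set (A : Set X)) =
        Metric.infEDist x.1 (B : Set X) := fun x => by
    rw [← Metric.infEDist_image isometry_subtype_coe, himage]
  refine ⟨?_, ?_, ?_, ?_, ?_, ?_⟩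
  · obtain ⟨b, hb⟩ := hB
    rw [hC]
    exact ⟨⟨b, hBA hb⟩, hb⟩
  · refine fun i x hx => ⟨_, (traceOpen A (W i)).isOpen, hx, ?_⟩
    refine (finite_singleton i).subset fun j hj => ?_
    obtain ⟨z, hz, hz'⟩ := hj
    by_contra hne
    have : z.1 ∈ (W j : Set X) ∩ (W i : Set X) := ⟨hz, hz'⟩
    rwa [hW j i hne] at this
  · simp
  · intro i
    have : (⟨y i, hBA (hy i)⟩ : (A : Set X)) ∈
        (((⨆ i, traceOpen A (W i)).compl : Closeds (A : Set X)) : Set (A : Set X)) := by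
      rw [hC]
      exact hy i
    exact this
  · intro i x hx
    rw [hC, hinf, one_add_one_eq_two]
    exact hdist i x.1 (hWV i hx)
  · intro n hn
    -- Each diameter is squeezed between `0` and the distance of the set to `B`.
    refine tendsto_of_tendsto_of_tendsto_of_le_of_le tendsto_const_nhds hn
      (fun _ => zero_le) fun i => ?_
    refine Metric.ediam_le fun x hx x' hx' => le_iInf₂ fun z hz => ?_
    rw [hC, hinfE, edist_dist, ← ENNReal.ofReal_toReal (Metric.infEDist_ne_top hB)]
    exact ENNReal.ofReal_le_ofReal
      (hdiam (n i) x.1 (hWV _ hx) x'.1 (hWV _ hx') z.1 (hWV _ hz))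

theorem projPair_eq {𝒴 : Set (Closeds X)} {A : 𝒴} {B : Closeds X} (hBA : (B : Set X) ⊆ A.1)
    {V W : ℕ → Opens X} {y : ℕ → X} (hV : ⋃ i, (V i : Set X) = (B : Set X)ᶜ)
    (hWA : (⋃ i, (W i : Set X)) ∩ (A.1 : Set X) = (⋃ i, (V i : Set X)) ∩ (A.1 : Set X))
    (h : (A, W, y) ∈ SystemsOver 𝒴) : projPair ⟨(A, W, y), h⟩ = (A, B) := by
  refine Prod.ext rfl (SetLike.coe_injective ?_)
  ext x
  have hx := Set.ext_iff.1 hWA x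
  rw [hV] at hx
  simp only [mem_inter_iff, mem_iUnion, mem_compl_iff] at hx
  have hx' := @hBA x
  simp only [projPair, Closeds.coe_inf, Opens.coe_compl, Opens.coe_iSup, mem_inter_iff,
    mem_compl_iff, mem_iUnion]
  tauto

/-! ### The certified balls around the points off a closed set -/

theorem nuQ_surjective : Function.Surjective nuQ := by
  intro q
  refine ⟨Nat.pair q.num.toNat (Nat.pair (-q.num).toNat (q.den - 1)), ?_⟩
  simp only [nuQ, Nat.unpair_pair]
  have h₁ : ((q.num.toNat : ℚ) - ((-q.num).toNat : ℚ)) = q.num := by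
    have : ((q.num.toNat : ℤ) - ((-q.num).toNat : ℤ)) = q.num := by omega
    exact_mod_cast this
  have h₂ : (((q.den - 1 : ℕ) : ℚ) + 1) = q.den := by
    have := q.den_pos
    exact_mod_cast (by omega : q.den - 1 + 1 = q.den)
  rw [h₁, h₂, Rat.num_div_den]

theorem exists_nuQpos_eq {q : ℚ} (hq : 0 < q) : ∃ r, nuQpos r = q := by
  refine ⟨Nat.pair (q.num.toNat - 1) (q.den - 1), ?_⟩
  simp only [nuQpos, Nat.unpair_pair]
  have h₁ : (((q.num.toNat - 1 : ℕ) : ℚ) + 1) = q.num := by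
    have := Rat.num_pos.2 hq
    have : ((q.num.toNat - 1 : ℕ) : ℤ) + 1 = q.num := by omega
    exact_mod_cast this
  have h₂ : (((q.den - 1 : ℕ) : ℚ) + 1) = q.den := by
    have := q.den_pos
    exact_mod_cast (by omega : q.den - 1 + 1 = q.den)
  rw [h₁, h₂, Rat.num_div_den]

theorem isOpen_ballNumShift (ν : ℕ → X) (n : ℕ) : IsOpen (ballNumShift ν n) := by
  cases n
  · exact isOpen_empty
  · exact Metric.isOpen_ball

/-- The `i`-th certified ball, as read off from the input `p`. -/
noncomputable def certBall (ν : ℕ → X) (f : ℕ × ℕ × ℕ → ℕ) (p : ℕ → ℕ) (i : ℕ) : Opens X :=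
  ⟨ballNumShift ν (ballCode f i (pre p i)), isOpen_ballNumShift ν _⟩

/-- A point `z` of the ball excludes the default value `∅`, so the certificate with number `i` was
accepted. -/
theorem certBall_sound {ν : ℕ → X} {f : ℕ × ℕ × ℕ → ℕ}
    (hf : ∀ i j k, |dist (ν i) (ν j) - ((nuQ (f (i, j, k)) : ℚ) : ℝ)| ≤ (2 : ℝ)⁻¹ ^ k)
    {B : Closeds X} (hB : (B : Set X).Nonempty) {p : ℕ → ℕ}
    (hp : distName ν (oddPart (oddPart p)) B) {y : ℕ → X}
    (hy : ∀ k, pointName ν (fun j => component (evenPart (oddPart p)) k j - 1) (y k)) {i : ℕ}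
    {z : X} (hz : z ∈ certBall ν f p i) : ∃ (x : X) (ρ q : ℝ),
      (certBall ν f p i : Set X) = Metric.ball x ρ ∧ q < Metric.infDist x B ∧ 8 * ρ < q ∧
        dist x (y (certPoint i)) < 3 / 2 * q := by
  change z ∈ ballNumShift ν _ at hz
  change ∃ (x : X) (ρ q : ℝ), ballNumShift ν _ = _ ∧ _
  rw [ballCode] at hz ⊢
  split_ifs at hz ⊢ with h
  · rw [take_pre p le_rfl] at h
    have := h.sound hf hB hp (hy _)
    refine ⟨_, _, _, ?_, this⟩
    simp [ballNumShift, ballNum]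
  · exact hz.elim

/-- A point off `B` has positive distance `D` to `B`, so every strict inequality of a certificate
holds for good approximations of the point, of a nearly nearest point of `B`, and of `D`. -/
theorem exists_mem_certBall {ν : ℕ → X} (hν : DenseRange ν) {f : ℕ × ℕ × ℕ → ℕ}
    (hf : ∀ i j k, |dist (ν i) (ν j) - ((nuQ (f (i, j, k)) : ℚ) : ℝ)| ≤ (2 : ℝ)⁻¹ ^ k)
    {B : Closeds X} (hB : (B : Set X).Nonempty) {p : ℕ → ℕ}
    (hp : distName ν (oddPart (oddPart p)) B) {y : ℕ → X}
    (hpos : ∀ k j, 1 ≤ component (evenPart (oddPart p)) k j)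
    (hy : ∀ k, pointName ν (fun j => component (evenPart (oddPart p)) k j - 1) (y k))
    (hdense : ∀ b ∈ B, ∀ ε > 0, ∃ k, dist (y k) b < ε) {x : X} (hx : x ∉ B) :
    ∃ i, x ∈ certBall ν f p i := by
  have hD : 0 < Metric.infDist x (B : Set X) := (B.isClosed.notMem_iff_infDist_pos hB).1 hx
  set D := Metric.infDist x (B : Set X)
  -- With these choices `8 * ρ < 0.4 * D < q < 0.95 * D`, the distance of `ν a` to `B` exceeds `0.99
  -- * D - ε` for every `ε > 0`, and `d (ν a, y k) < 1.21 * D < 1.35 * D < 3/2 * q`.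
  obtain ⟨b, hb, hxb⟩ := (Metric.infDist_lt_iff hB).1 (show D < 11 / 10 * D by linarith)
  obtain ⟨k, hk⟩ := hdense b hb (D / 10) (by positivity)
  obtain ⟨a, ha⟩ := hν.exists_dist_lt x (show 0 < D / 100 by positivity)
  obtain ⟨ρ, hρ, hρ'⟩ := exists_rat_btwn (show D / 100 < D / 20 by linarith)
  obtain ⟨q, hq, hq'⟩ := exists_rat_btwn (show 9 / 10 * D < 95 / 100 * D by linarith)
  obtain ⟨c, rfl⟩ := nuQ_surjective q
  obtain ⟨r, rfl⟩ := exists_nuQpos_eq (q := ρ)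
    (by exact_mod_cast (show (0 : ℝ) < D / 100 by positivity).trans hρ)
  have h₁ : D ≤ Metric.infDist (ν a) (B : Set X) + dist x (ν a) :=
    Metric.infDist_le_infDist_add_dist
  have h₂ := dist_triangle_left (ν a) (y k) x
  have h₃ := dist_triangle_right x (y k) b
  obtain ⟨n, m, l, L, h⟩ := Certificate.complete (c := c) (r := r) (a := a) hf hB hp (hy k)
    (hpos k) (by linarith) (by linarith) (by linarith)
  -- The component `L` is padding: it makes the index, which is also the length of the prefix
  -- consulted, large enough.
  refine ⟨Nat.pair L (Nat.pair k (Encodable.encode (a, r, n, m, c, l))), ?_⟩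
  set i := Nat.pair L (Nat.pair k (Encodable.encode (a, r, n, m, c, l))) with hi
  have hdata : certData i = (a, r, n, m, c, l) := by
    rw [certData, hi]
    simp only [Nat.unpair_pair]
    exact Denumerable.ofNat_encode _
  have hpoint : certPoint i = k := by simp [certPoint, hi]
  change x ∈ ballNumShift ν (ballCode f i (pre p i))
  rw [ballCode, take_pre p le_rfl, hdata, hpoint, if_pos (h i (Nat.left_le_pair _ _))]
  simp only [ballNumShift, ballNum, Nat.unpair_pair, Metric.mem_ball]
  linarith

end Metric

/-! ### The input for the disjointification and the final output -/

/-- The entries of the name of the certified balls and of the set `A`, computed from a prefix of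
the input. -/
noncomputable def ballsEntry (f : ℕ × ℕ × ℕ → ℕ) (x : ℕ × List ℕ) : ℕ :=
  if x.1 % 2 = 0 then ballCode f (x.1 / 2).unpair.1 x.2 else x.2.getD (x.1 - 1) 0

theorem computable_ballsEntry {f : ℕ × ℕ × ℕ → ℕ} (hf : Computable f) :
    Computable (ballsEntry f) := by
  have key : Primrec fun z : ℕ × ℕ × List ℕ =>
      if z.2.1 % 2 = 0 then z.1 else z.2.2.getD (z.2.1 - 1) 0 :=
    Primrec.ite (Primrec.eq.comp (Primrec.nat_mod.comp (Primrec.fst.comp Primrec.snd)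
      (Primrec.const 2)) (Primrec.const 0)) Primrec.fst
      ((Primrec.list_getD 0).comp (Primrec.snd.comp Primrec.snd)
        (Primrec.nat_sub.comp (Primrec.fst.comp Primrec.snd) (Primrec.const 1)))
  have index : Primrec fun x : ℕ × List ℕ => (x.1 / 2).unpair.1 :=
    primrec_unpair_fst (Primrec.nat_div.comp Primrec.fst (Primrec.const 2))
  exact (key.to_comp.comp (((computable_ballCode hf).comp
    (index.to_comp.pair Computable.snd)).pair Computable.id)).of_eq fun x => by
    simp only [ballsEntry, id_eq]

/-- The name `⟨p, ⟨p', ⟨⟨p', ⟨p', s⟩⟩, t⟩⟩⟩` of the output, where `w = ⟨⟨p, ⟨y, z⟩⟩, p'⟩`, the entry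
of `s` at `⟨j, k⟩` is the code of `{j}`, and `t` consists of the points with name in `y` that belong
to the certificates. -/
def assemble (w : ℕ → ℕ) (n : ℕ) : ℕ :=
  if n % 2 = 0 then w (2 * n)
  else if n % 4 = 1 then w (2 * (n / 4) + 1)
  else if n % 16 = 3 then w (2 * (n / 16) + 1)
  else if n % 32 = 11 then w (2 * (n / 32) + 1)
  else if n % 32 = 27 then 2 ^ (n / 32).unpair.1
  else w (8 * Nat.pair (certPoint (n / 8).unpair.1) (n / 8).unpair.2 + 2) - 1

/-- Every position read lies below `8 * (n + 1)`; for the points this uses that `certPoint` does not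
increase its argument and that pairing is monotone. -/
theorem assemble_congr {w w' : ℕ → ℕ} {n : ℕ} (h : ∀ i < 8 * (n + 1), w i = w' i) :
    assemble w n = assemble w' n := by
  have : Nat.pair (certPoint (n / 8).unpair.1) (n / 8).unpair.2 ≤ n / 8 :=
    calc _ ≤ Nat.pair (n / 8).unpair.1 (n / 8).unpair.2 :=
        (certPoint_le _).eq_or_lt.elim (fun h => by rw [h])
          fun h => (Nat.pair_lt_pair_left _ h).le
      _ = n / 8 := Nat.pair_unpair _
  rw [assemble, assemble, h (2 * n) (by omega), h (2 * (n / 4) + 1) (by omega),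
    h (2 * (n / 16) + 1) (by omega), h (2 * (n / 32) + 1) (by omega), h _ (by omega)]

/-! ### The components of the assembled name -/

theorem evenPart_assemble (w : ℕ → ℕ) : evenPart (assemble w) = evenPart (evenPart w) := by
  funext i
  simp [evenPart, assemble]

theorem evenPart_oddPart_assemble (w : ℕ → ℕ) : evenPart (oddPart (assemble w)) = oddPart w := by
  funext i
  simp only [evenPart, oddPart, assemble]
  rw [if_neg (by omega), if_pos (by omega)]
  congr 1
  omega

theorem assemble_trace (w : ℕ → ℕ) :
    evenPart (evenPart (oddPart (oddPart (assemble w)))) = oddPart w := by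
  funext i
  simp only [evenPart, oddPart, assemble]
  rw [if_neg (by omega), if_neg (by omega), if_pos (by omega)]
  congr 1
  omega

theorem assemble_union (w : ℕ → ℕ) :
    evenPart (oddPart (evenPart (oddPart (oddPart (assemble w))))) = oddPart w := by
  funext i
  simp only [evenPart, oddPart, assemble]
  rw [if_neg (by omega), if_neg (by omega), if_neg (by omega), if_pos (by omega)]
  congr 1
  omega

theorem assemble_finite (w : ℕ → ℕ) (i : ℕ) :
    oddPart (oddPart (evenPart (oddPart (oddPart (assemble w))))) i = 2 ^ i.unpair.1 := by
  simp only [evenPart, oddPart, assemble]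
  rw [if_neg (by omega), if_neg (by omega), if_neg (by omega), if_neg (by omega),
    if_pos (by omega)]
  congr 3
  omega

theorem assemble_points (w : ℕ → ℕ) (i : ℕ) :
    component (oddPart (oddPart (oddPart (assemble w)))) i =
      fun k => component (evenPart (oddPart (evenPart w))) (certPoint i) k - 1 := by
  funext k
  simp only [component, evenPart, oddPart, assemble]
  rw [if_neg (by omega), if_neg (by omega), if_neg (by omega), if_neg (by omega),
    if_neg (by omega)]
  have : (2 * (2 * (2 * Nat.pair i k + 1) + 1) + 1) / 8 = Nat.pair i k := by omega
  rw [this, Nat.unpair_pair]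
  congr 2
  ring

theorem computable_assemble :
    Computable fun x : ℕ × List ℕ => assemble (fun i => x.2.getD i 0) x.1 := by
  have n := @Primrec.fst ℕ (List ℕ) _ _
  have rem : ∀ d e, PrimrecPred fun x : ℕ × List ℕ => x.1 % d = e := fun d e =>
    Primrec.eq.comp (Primrec.nat_mod.comp n (Primrec.const d)) (Primrec.const e)
  have quo : ∀ d, Primrec fun x : ℕ × List ℕ => x.1 / d := fun d =>
    Primrec.nat_div.comp n (Primrec.const d)
  have read : ∀ {j : ℕ × List ℕ → ℕ}, Primrec j →
      Primrec fun x : ℕ × List ℕ => x.2.getD (j x) 0 := fun hj => (Primrec.list_getD 0).comp Primrec.snd hj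
  have odd : ∀ d, Primrec fun x : ℕ × List ℕ => 2 * (x.1 / d) + 1 := fun d =>
    primrec_add (primrec_mul (Primrec.const 2) (quo d)) (Primrec.const 1)
  have pow : Primrec fun j : ℕ => 2 ^ j := by
    refine (Primrec.nat_rec₁ (f := fun _ m => 2 * m) 1
      (primrec_mul (Primrec.const 2) Primrec.snd).to₂).of_eq fun j => ?_
    induction j with
    | zero => rfl
    | succ j ih => simp only [ih, pow_succ]; ring
  have point : Primrec certPoint := primrec_unpair_fst (primrec_unpair_snd Primrec.id)
  exact (Primrec.ite (rem 2 0) (read (primrec_mul (Primrec.const 2) n)) <|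
    Primrec.ite (rem 4 1) (read (odd 4)) <| Primrec.ite (rem 16 3) (read (odd 16)) <|
    Primrec.ite (rem 32 11) (read (odd 32)) <|
    Primrec.ite (rem 32 27) (pow.comp (primrec_unpair_fst (quo 32))) <|
    Primrec.nat_sub.comp (read (primrec_add (primrec_mul (Primrec.const 8)
      (Primrec₂.natPair.comp (point.comp (primrec_unpair_fst (quo 8)))
        (primrec_unpair_snd (quo 8)))) (Primrec.const 2))) (Primrec.const 1)).to_comp

theorem evenPart_interleave (p q : ℕ → ℕ) : evenPart (interleave p q) = p := by
  funext i
  simp [evenPart, interleave]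

theorem oddPart_interleave (p q : ℕ → ℕ) : oddPart (interleave p q) = q := by
  funext i
  simp only [oddPart, interleave]
  rw [if_neg (by omega)]
  congr 1
  omega

/-- If the `W i` are disjoint, then the `k`-th ball in the enumeration of `W j` meets only `W j`. -/
theorem lfNameRel_of_disjoint {X : Type*} [MetricSpace X] {ν : ℕ → X} (A : Closeds X)
    {W : ℕ → Opens X} (hW : ∀ i j, i ≠ j → (W i : Set X) ∩ (W j : Set X) = ∅) {q u : ℕ → ℕ}
    (hq : seqName (openName ν) q W) (h₁ : evenPart u = q) (h₂ : evenPart (oddPart u) = q)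
    (h₃ : ∀ i, oddPart (oddPart u) i = 2 ^ i.unpair.1) :
    lfNameRel ν A u fun i => traceOpen A (W i) := by
  have hq' : ∀ j, ((traceOpen A (W j) : Opens (A : Set X)) : Set (A : Set X)) =
      ⋃ k, ballNumRel ν A (q (Nat.pair j k)) := fun j => by
    have := hq j
    rw [openName] at this
    change Subtype.val ⁻¹' (W j : Set X) = _
    rw [this, preimage_iUnion]
    rfl
  refine ⟨fun j => ?_, ?_, fun i j hij => ?_⟩
  · rw [h₁]
    exact hq' j
  · rw [h₂]
    ext x
    simp only [hq', mem_iUnion]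
    constructor
    · rintro ⟨j, k, h⟩
      exact ⟨_, h⟩
    · rintro ⟨i, h⟩
      exact ⟨i.unpair.1, i.unpair.2, by rwa [Nat.pair_unpair]⟩
  · rw [h₂] at hij
    obtain ⟨x, hx, hx'⟩ := hij
    have hxi : x ∈ (traceOpen A (W i.unpair.1) : Set (A : Set X)) := by
      rw [hq']
      exact mem_iUnion.2 ⟨i.unpair.2, by rwa [Nat.pair_unpair]⟩
    have : i.unpair.1 = j := by
      by_contra hne
      have : x.1 ∈ (W i.unpair.1 : Set X) ∩ (W j : Set X) := ⟨hxi, hx⟩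
      rwa [hW _ _ hne] at this
    rw [h₃, this, Nat.testBit_two_pow_self]

end DugundjiZD

/-! ### The realizer and its correctness -/

theorem mainTheorem6 {X : Type*} [MetricSpace X] (ν : ℕ → X)
    (hν : DugundjiZD.IsComputableMetricSpace ν)
    (𝒴 : Set (TopologicalSpace.Closeds X))
    (hne : ∀ A ∈ 𝒴, (A : Set X).Nonempty)
    (δY : DugundjiZD.Naming 𝒴)
    (hrep : DugundjiZD.IsRepresentation δY)
    (hle : DugundjiZD.ReducibleTo δY
      (DugundjiZD.restrictName (DugundjiZD.closedName ν) 𝒴))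
    (hS : DugundjiZD.ComputableOperation
      (DugundjiZD.prodName (DugundjiZD.seqName (DugundjiZD.openName ν)) δY)
      (DugundjiZD.seqName (DugundjiZD.openName ν))
      Set.univ (DugundjiZD.disjointify 𝒴)) :
    DugundjiZD.ComputableOperation
      (DugundjiZD.inputName ν 𝒴 δY)
      (DugundjiZD.outputName ν 𝒴 δY)
      {P | (P.1.2 : Set X) ≠ Set.univ} (DugundjiZD.disjointSystems 𝒴) := by
  open DugundjiZD in
  obtain ⟨f, hf, hfdist⟩ := hν.dist_computable
  obtain ⟨s, hs, hsS⟩ := hS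
  have hballs := isType2Program_localProgram (computable_ballsEntry hf)
  have hpair := isType2Program_pairProgram (hs.comp hballs)
  have hout := isType2Program_localProgram computable_assemble
  refine ⟨_, hout.comp hpair, ?_⟩
  rintro ⟨⟨A, B⟩, hB, hBA⟩ - p ⟨hpA, hrange, hdist⟩
  dsimp only at hB hBA hpA hrange hdist
  obtain ⟨hB', -⟩ | ⟨-, hpoints, hdense⟩ := hrange
  · exact absurd hB' hB.ne_empty
  choose hpos y hyB hy using hpoints
  have hV : ⋃ i, (certBall ν f p i : Set X) = (B : Set X)ᶜ := by
    refine Subset.antisymm (iUnion_subset fun i z hz hzB => ?_) fun z hz => ?_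
    -- A point of `B` in the ball would give `8 * ρ < q < d (x, B) < ρ`, with `ρ` positive.
    · obtain ⟨x, ρ, q, hball, h₁, h₂, -⟩ := certBall_sound hfdist hB hdist hy hz
      rw [hball, Metric.mem_ball, dist_comm] at hz
      have := Metric.infDist_le_dist_of_mem (x := x) hzB
      have := dist_nonneg (x := x) (y := z)
      linarith
    · refine mem_iUnion.2 (exists_mem_certBall hν.dense hfdist hB hdist hpos hy ?_ hz)
      intro b hb ε hε
      obtain ⟨k, z, hz, hzk⟩ := hdense b hb _ Metric.isOpen_ball (Metric.mem_ball_self hε)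
      rw [tendsto_nhds_unique hzk.2 (hy k).2] at hz
      exact ⟨k, hz⟩
  have hq := produces_localProgram (ballsEntry f) p
  set q := fun n => ballsEntry f (n, pre p (8 * (n + 1)))
  have hqV : seqName (openName ν) (evenPart q) (certBall ν f p) := by
    intro i
    -- The name of the `i`-th ball is constant, since its code depends only on the first `i` entries
    -- of `p`, however long the available prefix is.
    have hi : ∀ k, component (evenPart q) i k = ballCode f i (pre p i) := by
      intro k
      have hik := Nat.left_le_pair i k
      have htake : (pre p (8 * (2 * Nat.pair i k + 1))).take i = (pre p i).take i := by
        rw [take_pre p (by omega), take_pre p le_rfl]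
      simp only [component, evenPart, q, ballsEntry]
      rw [if_pos (by omega), Nat.mul_div_cancel_left _ two_pos, Nat.unpair_pair, ballCode, htake,
        ballCode]
    simp only [openName, hi, iUnion_const]
    rfl
  have hqA : oddPart q = evenPart p := by
    funext i
    simp only [oddPart, evenPart, q, ballsEntry]
    rw [if_neg (by omega), getD_pre_of_lt p (by omega)]
    rfl
  obtain ⟨t, hqt, W, ⟨hWV, hWA, hW⟩, htW⟩ :=
    hsS (certBall ν f p, A) (mem_univ _) q ⟨hqV, hqA ▸ hpA⟩
  have hw := (hq.comp hs hqt).pairProgram (hs.comp hballs)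
  set w := interleave p t with hw'
  have hres := hw.comp hout (produces_localProgram _ w)
  have hassemble : (fun n => assemble (fun i => (pre w (8 * (n + 1))).getD i 0) n) =
      assemble w := by
    funext n
    exact assemble_congr fun i hi => getD_pre_of_lt w hi 0
  have hwp : evenPart w = p := evenPart_interleave p t
  have hwt : oddPart w = t := oddPart_interleave p t
  have hE : (A, W, fun i => y (certPoint i)) ∈ SystemsOver 𝒴 := by
    refine mem_relDugundjiSystems hB hBA hV (fun i => hyB _) ?_ ?_ hWV hWA hW
    -- From `d (z, B) > q - ρ` and `d (z, y) < ρ + 3/2 * q`, the factor `2` is enough once `6 * ρ ≤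
    -- q`.
    · intro i z hz
      obtain ⟨x, ρ, q, hball, h₁, h₂, h₃⟩ := certBall_sound hfdist hB hdist hy hz
      have hz' : z ∈ (certBall ν f p i : Set X) := hz
      rw [hball, Metric.mem_ball, dist_comm] at hz'
      have h₄ : Metric.infDist x (B : Set X) ≤ Metric.infDist z B + dist x z :=
        Metric.infDist_le_infDist_add_dist
      have h₅ := dist_triangle_left z (y (certPoint i)) x
      have h₆ := dist_nonneg (x := x) (y := z)
      linarith
    -- The diameter is at most `2 * ρ`, while `d (z, B) > q - ρ > 7 * ρ`.
    · intro i a ha b hb z hz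
      obtain ⟨x, ρ, q, hball, h₁, h₂, -⟩ := certBall_sound hfdist hB hdist hy hz
      change a ∈ (certBall ν f p i : Set X) at ha
      change b ∈ (certBall ν f p i : Set X) at hb
      change z ∈ (certBall ν f p i : Set X) at hz
      rw [hball, Metric.mem_ball] at ha hb hz
      have h₄ : Metric.infDist x (B : Set X) ≤ Metric.infDist z B + dist x z :=
        Metric.infDist_le_infDist_add_dist
      have h₅ := dist_triangle_right a b x
      have h₆ := dist_comm x z
      have h₇ := dist_nonneg (x := a) (y := x)
      linarith
  refine ⟨assemble w, hassemble ▸ hres, ⟨_, hE⟩, ⟨projPair_eq hBA hV hWA hE, hW⟩, ?_, ?_, ?_, ?_⟩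
  · rw [evenPart_assemble, hwp]
    exact hpA
  · rw [evenPart_oddPart_assemble, hwt]
    exact htW
  · exact lfNameRel_of_disjoint _ hW htW ((assemble_trace w).trans hwt)
      ((assemble_union w).trans hwt) (assemble_finite w)
  · intro i
    rw [assemble_points, hwp]
    exact hy _
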